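/- Let $k$ be a finite field, $X$ a smooth projective geometrically integral $k$-variety of dimension $r$, and $\mathcal P$ a finite set of $k$-rational points of $X$. Let $G$ be a divisor on $X$ with $\mathrm{Supp}(G)\cap\mathcal P=\emptyset$, and let $\mathcal D=\{D_1,\dots,D_r\}$ be effective divisors on $X$ that intersect properly (every irreducible component of $\cap_l D_l$ has codimension $r$, i.e. $\cap_l D_l$ is a finite set of closed points), with $\mathcal P\subseteq\cap_l D_l$. Put $D=\sum_l D_l$. For a divisor $E$ put $\Omega^r(E)=\{0\ne\omega\in\Omega^r_{k(X)/k} : (\omega)+E\ge 0\}\cup\{0\}$. For every $P\in\cap_l D_l$ fix generators $x_1,\dots,x_r$ of the maximal ideal $m_P\subset\mathcal O_P$, local equations $f_1,\dots,f_r$ of $D_1,\dots,D_r$ at $P$, an integer $a>0$ with all $x_i^a\in(f_1,\dots,f_r)$, and $r_{ij}\in\mathcal O_P$ with $x_i^a=\sum_j r_{ij}f_j$; put $R_P=\det(r_{ij})$. Germs $g\in\mathcal O_P$ are expanded as power series in $x_1,\dots,x_r$ with coefficients in the residue field $\kappa(P)$, through the unique $k$-algebra homomorphism $\mathcal O_P\to\kappa(P)[[x_1,\dots,x_r]]$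 that sends each $x_i$ to $x_i$ and whose constant term is the value at $P$. If $\omega\in\Omega^r_{k(X)/k}$ is such that $f_1\cdots f_r\,\omega$ is regular at $P$, write $R_P f_1\cdots f_r\,\omega=g\,dx_1\wedge\dots\wedge dx_r$ with $g\in\mathcal O_P$ and let $$\mathrm{Res}_P\begin{bmatrix}\omega\\ D_1,\dots,D_r\end{bmatrix}:=\mathrm{Tr}_{\kappa(P)/k}\bigl(\text{coefficient of }x_1^{a-1}\cdots x_r^{a-1}\text{ in the expansion of }g\bigr)\in k .$$ A function $\theta\in k(X)$ is called $(\mathcal D,\mathcal P)$-rectifying if it is regular at every $P\in\cap_l D_l$ and, modulo $(x_1^a,\dots,x_r^a)$, the expansion of $R_P\theta$ is congruent to $c\,x_1^{a-1}\cdots x_r^{a-1}$ for some $c\in k$ if $P\in\mathcal P$, and to $0$ if $P\in\cap_l D_l\setminus\mathcal P$. Let $\theta\neq 0$ be $(\mathcal D,\mathcal P)$-rectifying, let $(\theta)^+$ be the positive part of its divisor, let $h\in k(X)$ be regular at every point of $\cap_l D_l$, and let $\omega\in\Omega^r(D-G-(\theta)^+)$. Let $P\in\cap_l D_l$; if $P\notin\mathcal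 P$, assume moreover that no prime divisor through $P$ has a negative coefficient in $G$. Then $f_1\cdots f_r\,\omega$ and $f_1\cdots f_r\,h\omega$ are regular at $P$ (so that the residues below are defined), and $$\mathrm{Res}_P\begin{bmatrix}h\omega\\ D_1,\dots,D_r\end{bmatrix}=h(P)\,\mathrm{Res}_P\begin{bmatrix}\omega\\ D_1,\dots,D_r\end{bmatrix}$$ as elements of $\kappa(P)\supseteq k$. Moreover, if $P\in\cap_l D_l\setminus\mathcal P$, then $\mathrm{Res}_P\begin{bmatrix}\omega\\ D_1,\dots,D_r\end{bmatrix}=0$. -/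

import Mathlib

open AlgebraicGeometry CategoryTheory

universe u

namespace ResidueCode

noncomputable section

attribute [local instance] MvPolynomial.gradedAlgebra

/-- A scheme `X` over a field `k` is projective if it admits a closed immersion over `k` into some
projective space `ℙⁿ = Proj k[T₀, …, Tₙ]`. -/
def IsProjective {k : Type u} [Field k] {X : Scheme.{u}} (π : X ⟶ Spec (.of k)) : Prop :=
  ∃ (n : ℕ) (ι : X ⟶ Proj (MvPolynomial.homogeneousSubmodule (Fin (n + 1)) k)),
    IsClosedImmersion ι ∧
      ι ≫ Proj.toSpecZero (MvPolynomial.homogeneousSubmodule (Fin (n + 1)) k) ≫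
        Spec.map (CommRingCat.ofHom
          (algebraMap k (MvPolynomial.homogeneousSubmodule (Fin (n + 1)) k 0))) = π

/-- A smooth projective variety (geometrically integral) of dimension `r` over the field `k`. -/
structure SmoothProjectiveVariety (k : Type u) [Field k] (r : ℕ) where
  toScheme : Scheme.{u}
  str : toScheme ⟶ Spec (.of k)
  geometricallyIntegral : GeometricallyIntegral str
  smooth : SmoothOfRelativeDimension r str
  projective : IsProjective str

instance {k : Type u} [Field k] {r : ℕ} (X : SmoothProjectiveVariety k r) :
    X.toScheme.Over (Spec (.of k)) := ⟨X.str⟩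

instance {k : Type u} [Field k] {r : ℕ} (X : SmoothProjectiveVariety k r) :
    IsIntegral X.toScheme :=
  have := X.geometricallyIntegral
  GeometricallyIntegral.isIntegral_of_subsingleton X.str

instance {k : Type u} [Field k] {r : ℕ} (X : SmoothProjectiveVariety k r) :
    IsLocallyNoetherian X.toScheme :=
  have := X.smooth
  have : Smooth X.str := SmoothOfRelativeDimension.smooth r X.str
  LocallyOfFiniteType.isLocallyNoetherian X.str

section Local

variable (k : Type u) [Field k] {X : Scheme.{u}} [X.Over (Spec (.of k))]

/-- The local ring `𝒪_P` of a `k`-scheme is a `k`-algebra through the structure morphism. In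
particular (at the generic point) so is the function field `k(X)`. -/
instance stalkAlgebra (P : X) : Algebra k (X.presheaf.stalk P) :=
  ((Scheme.ΓSpecIso (.of k)).inv ≫ (X ↘ Spec (.of k)).appTop ≫
    X.presheaf.germ ⊤ P (TopologicalSpace.Opens.mem_top P)).hom.toAlgebra

instance stalkTower [IsIntegral X] (P : X) :
    IsScalarTower k (X.presheaf.stalk P) X.functionField := by
  apply IsScalarTower.of_algebraMap_eq'
  simp_rw [RingHom.algebraMap_toAlgebra]
  change _ = (((Scheme.ΓSpecIso (.of k)).inv ≫ (X ↘ Spec (.of k)).appTop ≫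
    X.presheaf.germ ⊤ P (TopologicalSpace.Opens.mem_top P)) ≫ X.presheaf.stalkSpecializes _).hom
  rw [Category.assoc, Category.assoc, X.presheaf.germ_stalkSpecializes]

/-- The residue field `κ(P)`. -/
abbrev ResField (P : X) : Type u := IsLocalRing.ResidueField (X.presheaf.stalk P)

/-- `P` is a `k`-rational point: `κ(P) = k`. -/
def IsRationalPoint (P : X) : Prop := Function.Surjective (algebraMap k (ResField P))

/-- `τ : 𝒪_P → κ(P)⟦X₁, …, X_r⟧` is the power series expansion of germs in the generators
`x₁, …, x_r` of `m_P`: a homomorphism of `k`-algebras that sends `xᵢ` to `Xᵢ` and whose constant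
term is the value at `P`. (At a closed point of a smooth `r`-dimensional variety over a perfect
field there is exactly one.) -/
def IsExpansion {r : ℕ} {P : X} (x : Fin r → X.presheaf.stalk P)
    (τ : X.presheaf.stalk P →ₐ[k] MvPowerSeries (Fin r) (ResField P)) : Prop :=
  (∀ i, τ (x i) = MvPowerSeries.X i) ∧
    ∀ g, MvPowerSeries.constantCoeff (τ g) = IsLocalRing.residue (X.presheaf.stalk P) g

open Classical in
/-- The power series expansion of `g ∈ 𝒪_P` in the generators `x₁, …, x_r` of `m_P`. -/
def expansion {r : ℕ} {P : X} (x : Fin r → X.presheaf.stalk P) (g : X.presheaf.stalk P) :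
    MvPowerSeries (Fin r) (ResField P) :=
  if h : ∃ τ : X.presheaf.stalk P →ₐ[k] MvPowerSeries (Fin r) (ResField P), IsExpansion k x τ
  then h.choose g else 0

variable [IsIntegral X]

variable (X) in
/-- `Ω^r(X)`: the rational `r`-differentials of `X`, that is `⋀^r Ω_{k(X)/k}` over `k(X)`. -/
abbrev RationalForm (r : ℕ) : Type u := ⋀[X.functionField]^r (Ω[X.functionField⁄k])

/-- `h ∈ k(X)` is regular at `P`: it comes from `𝒪_P`. -/
def IsRegularAt (h : X.functionField) (P : X) : Prop :=
  ∃ g : X.presheaf.stalk P, algebraMap (X.presheaf.stalk P) X.functionField g = h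

open Classical in
/-- The value `h(P) ∈ κ(P)` of a rational function that is regular at `P`. -/
def valueAt (h : X.functionField) (P : X) : ResField P :=
  if hh : IsRegularAt h P then IsLocalRing.residue (X.presheaf.stalk P) hh.choose else 0

/-- For germs `x₁, …, x_r ∈ 𝒪_P`, the differential `dx₁ ∧ ⋯ ∧ dx_r ∈ Ω^r(X)`. -/
def wedge {r : ℕ} {P : X} (x : Fin r → X.presheaf.stalk P) : RationalForm k X r :=
  exteriorPower.ιMulti X.functionField r fun i =>
    KaehlerDifferential.D k X.functionField
      (algebraMap (X.presheaf.stalk P) X.functionField (x i))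

/-- The `r`-differentials that are regular at (hence in a neighbourhood of) `P`: the image of
`⋀^r Ω_{𝒪_P/k}` in `⋀^r Ω_{k(X)/k}`, which is generated over `𝒪_P` by the `dt₁ ∧ ⋯ ∧ dt_r` with
`tᵢ ∈ 𝒪_P`. -/
def regularForms (r : ℕ) (P : X) : Submodule (X.presheaf.stalk P) (RationalForm k X r) :=
  Submodule.span _ (Set.range fun t : Fin r → X.presheaf.stalk P => wedge k t)

open Classical in
/-- The coefficient `g ∈ 𝒪_P` of a differential `η = g dx₁ ∧ ⋯ ∧ dx_r` that is regular at `P`. -/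
def formCoeff {r : ℕ} {P : X} (x : Fin r → X.presheaf.stalk P) (η : RationalForm k X r) :
    X.presheaf.stalk P :=
  if h : ∃ g : X.presheaf.stalk P, η = g • wedge k x then h.choose else 0

/-- The residue symbol `Res_P [η; x₁^a, …, x_r^a]`, for `η` regular at `P`: the trace to `k` of the
coefficient of `x₁^(a-1) ⋯ x_r^(a-1)` in the expansion `η = ∑ c_I x^I dx₁ ∧ ⋯ ∧ dx_r`. -/
def residueSymbol {r : ℕ} {P : X} (x : Fin r → X.presheaf.stalk P) (a : ℕ)
    (η : RationalForm k X r) : k :=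
  Algebra.trace k (ResField P)
    (MvPowerSeries.coeff (Finsupp.equivFunOnFinite.symm fun _ => a - 1)
      (expansion k x (formCoeff k x η)))

end Local

section Divisors

variable (X : Scheme.{u})

/-- Prime divisors of `X`, given by their generic points (the points of codimension one). -/
abbrev PrimeDivisor : Type u := {z : X // Order.coheight z = 1}

/-- (Weil) divisors on a Noetherian scheme. -/
abbrev Divisor : Type u := PrimeDivisor X →₀ ℤ

variable {X}

/-- The support of a divisor: the union of the prime divisors with nonzero coefficient. -/
def Supp (D : Divisor X) : Set X := {P | ∃ Z, D Z ≠ 0 ∧ Z.1 ⤳ P}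

/-- The set-theoretic intersection `D₁ ∩ ⋯ ∩ D_r`. -/
def inter {r : ℕ} (D : Fin r → Divisor X) : Set X := ⋂ l, Supp (D l)

/-- `D₁, …, D_r` intersect properly: `D₁ ∩ ⋯ ∩ D_r` has codimension `r` at each of its points. -/
def IntersectProperly {r : ℕ} (D : Fin r → Divisor X) : Prop :=
  ∀ P ∈ inter D, Order.coheight P = (r : ℕ∞)

variable [IsIntegral X] [IsLocallyNoetherian X]

/-- The positive part `(θ)⁺` of the divisor of `θ ∈ k(X)ˣ`. -/
def divPos (θ : X.functionField) (Z : PrimeDivisor X) : ℤ := max (X.ord θ Z.1) 0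

/-- `f ∈ 𝒪_P` is a local equation at `P` of the divisor `D`: the divisor of `f` and `D` have the
same coefficient at every prime divisor through `P`. -/
def IsLocalEquation (D : Divisor X) (P : X) (f : X.presheaf.stalk P) : Prop :=
  f ≠ 0 ∧ ∀ Z : PrimeDivisor X, Z.1 ⤳ P →
    X.ord (algebraMap (X.presheaf.stalk P) X.functionField f) Z.1 = D Z

variable (k : Type u) [Field k] [X.Over (Spec (.of k))]

open Classical in
/-- The order `ord_Z(ω)` along the prime divisor `Z` of a nonzero rational `r`-differential `ω` on a
smooth variety: the order of `g`, where `ω = g η` with `η` a generator of the module of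
`r`-differentials that are regular at the generic point of `Z`. -/
def formOrd {r : ℕ} (ω : RationalForm k X r) (Z : PrimeDivisor X) : ℤ :=
  if h : ∃ (g : X.functionField) (η : RationalForm k X r),
      regularForms k r Z.1 = Submodule.span (X.presheaf.stalk Z.1) {η} ∧ ω = g • η
  then X.ord h.choose Z.1 else 0

/-- `Ω^r(E) = {ω ≠ 0 | (ω) + E ≥ 0} ∪ {0}`. -/
def formsBoundedBy (r : ℕ) (E : PrimeDivisor X → ℤ) : Set (RationalForm k X r) :=
  {ω | ω = 0 ∨ ∀ Z, 0 ≤ formOrd k ω Z + E Z}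

/-- The choices made at a point `P` of `D₁ ∩ ⋯ ∩ D_r`: generators `x₁, …, x_r` of `m_P`, local
equations `f₁, …, f_r` of `D₁, …, D_r` at `P`, an exponent `a > 0` with `xᵢ^a ∈ (f₁, …, f_r)`, and
an expression `xᵢ^a = ∑ⱼ ρᵢⱼ fⱼ`. -/
structure LocalChoice {r : ℕ} (D : Fin r → Divisor X) (P : X) where
  x : Fin r → X.presheaf.stalk P
  span_x : Ideal.span (Set.range x) = IsLocalRing.maximalIdeal (X.presheaf.stalk P)
  f : Fin r → X.presheaf.stalk P
  f_eq : ∀ l, IsLocalEquation (D l) P (f l)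
  a : ℕ
  a_pos : 0 < a
  ρ : Matrix (Fin r) (Fin r) (X.presheaf.stalk P)
  x_pow : ∀ i, x i ^ a = ∑ j, ρ i j * f j

/-- `R_P(x, f, a) = det(ρᵢⱼ)`. -/
def LocalChoice.R {r : ℕ} {D : Fin r → Divisor X} {P : X} (c : LocalChoice D P) :
    X.presheaf.stalk P := c.ρ.det

/-- The residue `Res_P [η; f₁, …, f_r] = Res_P [R_P(x, f, a) η; x₁^a, …, x_r^a]` of a differential
`η` that is regular at `P`. -/
def systemResidue {r : ℕ} {D : Fin r → Divisor X} {P : X} (c : LocalChoice D P)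
    (η : RationalForm k X r) : k :=
  residueSymbol k c.x c.a (c.R • η)

/-- `f₁ ⋯ f_r ω` is regular at `P`: the condition under which the residue of `ω` relative to
`D₁, …, D_r` at `P` is defined. -/
def HasResidue {r : ℕ} {D : Fin r → Divisor X} {P : X} (c : LocalChoice D P)
    (ω : RationalForm k X r) : Prop :=
  (∏ l, c.f l) • ω ∈ regularForms k r P

/-- The residue `Res_P [ω; D₁, …, D_r] = Res_P [f₁ ⋯ f_r ω; f₁, …, f_r]`. -/
def residue {r : ℕ} {D : Fin r → Divisor X} {P : X} (c : LocalChoice D P)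
    (ω : RationalForm k X r) : k :=
  systemResidue k c ((∏ l, c.f l) • ω)

/-- `θ ∈ k(X)` is `(𝒟, 𝒫)`-rectifying: `θ` is regular at every point `P` of `D₁ ∩ ⋯ ∩ D_r` and,
modulo `(x₁^a, …, x_r^a)`, the power series expansion of `R_P(x, f, a) θ` in `x₁, …, x_r` is
`c x₁^(a-1) ⋯ x_r^(a-1)` for some `c ∈ k` if `P ∈ 𝒫`, and is zero if `P ∉ 𝒫`. -/
def IsRectifying {r : ℕ} {D : Fin r → Divisor X} (𝒸 : ∀ P ∈ inter D, LocalChoice D P)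
    (Ps : Finset X) (θ : X.functionField) : Prop :=
  ∀ (P : X) (hP : P ∈ inter D), ∃ t : X.presheaf.stalk P,
    algebraMap (X.presheaf.stalk P) X.functionField t = θ ∧
    (P ∈ Ps → ∃ c : k,
      expansion k (𝒸 P hP).x ((𝒸 P hP).R * t) -
          MvPowerSeries.C (algebraMap k (ResField P) c) *
            ∏ j, MvPowerSeries.X j ^ ((𝒸 P hP).a - 1) ∈
        Ideal.span (Set.range fun j : Fin r =>
          (MvPowerSeries.X j ^ (𝒸 P hP).a : MvPowerSeries (Fin r) (ResField P)))) ∧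
    (P ∉ Ps →
      expansion k (𝒸 P hP).x ((𝒸 P hP).R * t) ∈
        Ideal.span (Set.range fun j : Fin r =>
          (MvPowerSeries.X j ^ (𝒸 P hP).a : MvPowerSeries (Fin r) (ResField P))))

end Divisors

end

end ResidueCode

/-!
Write `f₁ ⋯ f_r ω = g dx₁ ∧ ⋯ ∧ dx_r` near `P`. The pole condition says that `g / θ` has nonnegative
order along every prime divisor through `P`, hence `g = θ u` with `u` regular at `P`, because `𝒪_P`
is a Noetherian normal domain (`exists_prod_smul_eq`). As `θ` is rectifying, `R_P θ` is congruent to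
`c x₁^(a-1) ⋯ x_r^(a-1)` modulo `(x₁^a, …, x_r^a)` with `c ∈ k`, so the coefficient of
`x₁^(a-1) ⋯ x_r^(a-1)` in `R_P θ u` is `c u(P)`, and in `R_P θ h u` it is `c h(P) u(P)`
(`coeff_mul_of_sub_mem_span_X_pow`). For `P ∈ 𝒫` the trace is the identity, and for the other points
`c = 0`.

The coordinate system behind this comes from the following facts. A smooth `k`-scheme of relative
dimension `r` is locally étale over affine space. Hence it is normal
(`isIntegrallyClosed_of_etale`), and a point of codimension `r` has a finite residue field
(`isMaximal_of_height_eq`). If that field has `q` elements, a germ `t` has `t - t^q ∈ m_P`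
and `d (t - t^q) = d t`, so Nakayama's lemma shows that generators `x₁, …, x_r` of `m_P` have differentials
that generate the differentials at `P` and at its generizations
(`span_D_eq_top_of_span_eq_maximalIdeal`, `regularForms_eq_span_wedge`). As `Ω_{k(X)/k}` has
dimension `r` these differentials form a basis, and orders of forms along divisors through `P` are
orders of their coefficients (`formOrd_smul_wedge`). The regularity criterion used above is
`mem_range_of_forall_height_one` together with `mem_range_stalk_of_ord_nonneg`.
-/

/-! ### Normality, heights and differentials of smooth algebras -/

namespace ResidueCode

section CommutativeAlgebra

/-- An étale domain over an integrally closed domain is integrally closed: integral closure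
commutes with smooth base change, and `S ⊗[R] Frac R` is the fraction field of `S`. -/
theorem isIntegrallyClosed_of_etale (R S : Type*) [CommRing R] [IsDomain R] [IsIntegrallyClosed R]
    [CommRing S] [IsDomain S] [Algebra R S] [Algebra.Etale R S] : IsIntegrallyClosed S := by
  let F := FractionRing R
  let L := TensorProduct R S F
  have hflat : Module.Flat R S := inferInstance
  have hinj : Function.Injective (algebraMap R S) := FaithfulSMul.algebraMap_injective R S
  have hM : Algebra.algebraMapSubmonoid S (nonZeroDivisors R) ≤ nonZeroDivisors S :=
    map_le_nonZeroDivisors_of_injective _ hinj le_rfl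
  have hloc : IsLocalization (Algebra.algebraMapSubmonoid S (nonZeroDivisors R)) L :=
    IsLocalization.tensor F (nonZeroDivisors R)
  have : IsDomain L := IsLocalization.isDomain_of_le_nonZeroDivisors L hM
  -- `L` is a domain that is finite over the field `F`
  have hL : IsField L := by
    let e : L ≃+* TensorProduct R F S := (Algebra.TensorProduct.comm R S F).toRingEquiv
    have : IsDomain (TensorProduct R F S) := e.symm.toMulEquiv.isDomain L
    have : Module.Finite F (TensorProduct R F S) := Module.Finite.of_quasiFinite
    exact MulEquiv.isField (isField_of_isIntegral_of_isField' (R := F) (Field.toIsField F))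
      e.toMulEquiv
  let := hL.toField
  have hSL : Function.Injective (algebraMap S L) := IsLocalization.injective L hM
  have : IsFractionRing S L :=
    IsLocalization.of_le (Algebra.algebraMapSubmonoid S (nonZeroDivisors R)) _ hM fun s hs =>
      (isUnit_iff_ne_zero (a := algebraMap S L s)).mpr
        ((map_ne_zero_iff _ hSL).mpr (nonZeroDivisors.ne_zero hs))
  refine (isIntegrallyClosed_iff L).mpr fun {x} hx => ?_
  obtain ⟨w, hw⟩ := (TensorProduct.toIntegralClosure_bijective_of_smooth (R := R) (S := S)
    (B := F)).2 ⟨x, hx⟩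
  obtain rfl : ((TensorProduct.toIntegralClosure R S F w : integralClosure S L) : L) = x :=
    congrArg Subtype.val hw
  clear hw hx
  induction w with
  | zero => exact ⟨0, by simp⟩
  | add w₁ w₂ h₁ h₂ =>
    obtain ⟨y₁, h₁⟩ := h₁
    obtain ⟨y₂, h₂⟩ := h₂
    exact ⟨y₁ + y₂, by rw [map_add, h₁, h₂, map_add]; rfl⟩
  | tmul s c =>
    obtain ⟨c, hc⟩ := c
    obtain ⟨c, rfl⟩ := IsIntegrallyClosed.isIntegral_iff.mp hc
    refine ⟨c • s, ?_⟩
    change (c • s) ⊗ₜ[R] (1 : F) = s ⊗ₜ[R] algebraMap R F c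
    rw [TensorProduct.smul_tmul, Algebra.algebraMap_eq_smul_one]

/-- In an étale algebra over `k[T₁, …, T_r]` primes contract to primes of at least the same height,
so that no prime has height above `r`. -/
theorem isMaximal_of_height_eq (k A : Type*) [Field k] [CommRing A] [Algebra k A]
    (r : ℕ) [Algebra.IsStandardSmoothOfRelativeDimension r k A] (p : Ideal A) [p.IsPrime]
    (hp : p.height = r) : p.IsMaximal := by
  obtain ⟨g, hg⟩ := Algebra.IsStandardSmoothOfRelativeDimension.exists_etale_mvPolynomial r k A
  algebraize [g.toRingHom]
  let R := MvPolynomial (Fin r) k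
  have hstrict : StrictMono (PrimeSpectrum.comap (algebraMap R A)) := by
    intro P Q h
    refine lt_of_le_of_ne (Ideal.comap_mono h.le) fun he => h.ne ?_
    exact PrimeSpectrum.ext (Algebra.QuasiFinite.eq_of_le_of_under_eq (R := R) _ _ h.le
      congr(($he).asIdeal))
  have hle (M : Ideal A) [M.IsPrime] : M.height ≤ r := by
    have h1 : M.height ≤ (M.comap (algebraMap R A)).height := by
      have := Order.height_le_height_apply_of_strictMono _ hstrict ⟨M, inferInstance⟩
      rwa [← PrimeSpectrum.height_eq_orderHeight, ← PrimeSpectrum.height_eq_orderHeight] at this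
    have h2 := Ideal.height_le_ringKrullDim_of_isPrime (I := M.comap (algebraMap R A))
    rw [MvPolynomial.ringKrullDim_of_isNoetherianRing, ringKrullDim_eq_zero_of_field] at h2
    simp only [Nat.card_eq_fintype_card, Fintype.card_fin, zero_add] at h2
    exact h1.trans (by exact_mod_cast h2)
  obtain ⟨M, hM, hpM⟩ := p.exists_le_maximal Ideal.IsPrime.ne_top'
  rcases hpM.lt_or_eq with h | rfl
  · have := Ideal.height_add_one_le_of_lt_of_isPrime h
    have := this.trans (hle M)
    rw [hp] at this
    exact absurd this (by norm_cast; omega)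
  · exact hM

theorem finite_quotient_of_isMaximal (k A : Type*) [Field k] [Finite k] [CommRing A] [Algebra k A]
    [Algebra.FiniteType k A] (p : Ideal A) [p.IsMaximal] : Finite (A ⧸ p) := by
  let := Ideal.Quotient.field p
  have := finite_of_finite_type_of_isJacobsonRing k (A ⧸ p)
  exact Module.finite_of_finite k

/-- A Noetherian integrally closed domain is the intersection of its localizations at the primes
of height one. If `y ∉ A`, an ideal that is maximal among the ideals of
denominators of the multiples `c y ∉ A` is a prime of height one, and contains the denominators
of `y`. -/
theorem mem_range_of_forall_height_one {A K : Type*} [CommRing A] [IsDomain A] [IsNoetherianRing A]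
    [IsIntegrallyClosed A] [Field K] [Algebra A K] [IsFractionRing A K] (y : K)
    (hy : ∀ (q : Ideal A) [q.IsPrime], q.height = 1 →
      ∃ s ∉ q, algebraMap A K s * y ∈ (algebraMap A K).range) :
    y ∈ (algebraMap A K).range := by
  by_contra hyA
  let J (z : K) : Ideal A :=
    { carrier := {s | algebraMap A K s * z ∈ (algebraMap A K).range}
      add_mem' := fun {a b} ha hb => by
        simpa [add_mul] using add_mem (show _ ∈ (algebraMap A K).range from ha) hb
      zero_mem' := by simp
      smul_mem' := fun c a ha => by
        simpa [mul_assoc] using mul_mem (show algebraMap A K c ∈ (algebraMap A K).range from ⟨c, rfl⟩)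
          (show _ ∈ (algebraMap A K).range from ha) }
  have hJ (z : K) (s : A) : s ∈ J z ↔ algebraMap A K s * z ∈ (algebraMap A K).range := Iff.rfl
  -- `J z` is the ideal of denominators of `z`
  obtain ⟨q, ⟨c, hc, rfl⟩, hmax⟩ := set_has_maximal_iff_noetherian.mpr ‹IsNoetherianRing A›
    {q | ∃ c : A, algebraMap A K c * y ∉ (algebraMap A K).range ∧ q = J (algebraMap A K c * y)}
    ⟨_, 1, by simpa using hyA, rfl⟩
  set z := algebraMap A K c * y with hz
  have hprime : (J z).IsPrime := by
    refine ⟨fun h => hc ?_, fun {u v} huv => or_iff_not_imp_left.mpr fun hu => ?_⟩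
    · simpa using (hJ z 1).mp (h ▸ trivial)
    · have hle : J z ≤ J (algebraMap A K u * z) := fun s hs => by
        rw [hJ] at hs ⊢
        rw [mul_left_comm]
        exact mul_mem ⟨u, rfl⟩ hs
      have heq : J z = J (algebraMap A K u * z) := by
        refine eq_of_le_of_not_lt hle (hmax _ ⟨u * c, ?_, ?_⟩)
        · rwa [map_mul, mul_assoc]
        · rw [map_mul, mul_assoc]
      rw [heq, hJ, ← mul_assoc, mul_comm (algebraMap A K v), ← map_mul]
      exact huv
  -- `z` does not stabilize its ideal of denominators, as it is not integral
  obtain ⟨t, ht, u, hu, htu⟩ : ∃ t ∈ J z, ∃ u ∉ J z, algebraMap A K u = algebraMap A K t * z := by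
    by_contra! hstab
    refine hc (IsIntegrallyClosed.isIntegral_iff.mp ?_)
    obtain ⟨⟨a, b⟩, hab⟩ := IsLocalization.surj (nonZeroDivisors A) z
    have hb0 : algebraMap A K b ≠ 0 := by simp
    refine isIntegral_of_smul_mem_submodule (M := K)
      (Submodule.map (Algebra.linearMap A K) (J z)) ?_ ((IsNoetherian.noetherian (J z)).map _) z ?_
    · intro h
      have : algebraMap A K b ∈ Submodule.map (Algebra.linearMap A K) (J z) :=
        ⟨b, (hJ _ _).mpr ⟨a, by rw [mul_comm, hab]⟩, rfl⟩
      rw [h] at this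
      exact hb0 ((Submodule.mem_bot A).mp this)
    · rintro _ ⟨t, ht, rfl⟩
      obtain ⟨u, hu⟩ := (hJ _ _).mp ht
      refine ⟨u, ?_, ?_⟩
      · by_contra hu'
        exact hstab t ht u hu' hu
      · simpa [mul_comm] using hu
  have hmin : J z ∈ (Ideal.span {t}).minimalPrimes := by
    refine ⟨⟨hprime, by simpa [Ideal.span_le] using ht⟩, fun q' ⟨hq', htq'⟩ hle w hw => ?_⟩
    obtain ⟨v, hv⟩ := (hJ _ _).mp hw
    refine (hq'.mem_or_mem (x := w) (y := u) ?_).resolve_right fun h => hu (hle h)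
    have : w * u = v * t := by
      apply IsFractionRing.injective A K
      rw [map_mul, map_mul, hv, htu]
      ring
    rw [this]
    exact Ideal.mul_mem_left _ _ (htq' (Ideal.mem_span_singleton_self t))
  have hne : J z ≠ ⊥ := fun h => by
    have h0 : t = 0 := by simpa [h] using ht
    have : u = 0 := by
      apply IsFractionRing.injective A K
      rw [htu, h0]; simp
    exact hu (this ▸ zero_mem _)
  have hht : (J z).height = 1 :=
    le_antisymm (Ideal.height_le_one_of_isPrincipal_of_mem_minimalPrimes _ _ hmin)
      (Order.one_le_iff_ne_zero.mpr (mt Ideal.height_eq_zero_iff_eq_bot.mp hne))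
  obtain ⟨s, hs, hsy⟩ := hy (J z) hht
  refine hs ((hJ _ _).mpr ?_)
  rw [hz, mul_left_comm]
  exact mul_mem ⟨c, rfl⟩ hsy

/-- Generators of the maximal ideal of a local `k`-algebra `O` with finite residue field and finite
module of differentials have differentials that generate `Ω_{O/k}`: modulo `m Ω` the differentials
of elements of `m` suffice, since `t ^ q - t ∈ m` with `d (t ^ q) = 0` for `q = #κ`, and Nakayama's
lemma applies. -/
theorem span_D_eq_top_of_span_eq_maximalIdeal (k O : Type*) [Field k] [CommRing O]
    [IsLocalRing O] [Algebra k O] [Module.Finite O (Ω[O⁄k])]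
    [Finite k] [Finite (IsLocalRing.ResidueField O)] {ι : Type*} (x : ι → O)
    (hx : Ideal.span (Set.range x) = IsLocalRing.maximalIdeal O) :
    Submodule.span O (Set.range fun i => KaehlerDifferential.D k O (x i)) = ⊤ := by
  let m := IsLocalRing.maximalIdeal O
  let N := Submodule.span O (Set.range fun i => KaehlerDifferential.D k O (x i))
  have hm : ∀ t ∈ m, KaehlerDifferential.D k O t ∈ N ⊔ m • (⊤ : Submodule O (Ω[O⁄k])) := by
    intro t ht
    rw [show m = _ from hx.symm] at ht
    refine Submodule.span_induction (p := fun t _ => KaehlerDifferential.D k O t ∈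
      N ⊔ m • (⊤ : Submodule O (Ω[O⁄k]))) ?_ (by simp) ?_ ?_ ht
    · rintro _ ⟨i, rfl⟩
      exact Submodule.mem_sup_left (Submodule.subset_span ⟨i, rfl⟩)
    · intro a b _ _ ha hb
      rw [map_add]
      exact add_mem ha hb
    · intro c a ha hb
      rw [smul_eq_mul, Derivation.leibniz]
      refine add_mem (Submodule.smul_mem _ _ hb) (Submodule.mem_sup_right ?_)
      exact Submodule.smul_mem_smul (show a ∈ m by rw [show m = _ from hx.symm]; exact ha) trivial
  have hall : ∀ t, KaehlerDifferential.D k O t ∈ N ⊔ m • (⊤ : Submodule O (Ω[O⁄k])) := by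
    intro t
    let κ := IsLocalRing.ResidueField O
    have := Fintype.ofFinite κ
    have h1 : t ^ Fintype.card κ - t ∈ m := by
      rw [← IsLocalRing.residue_eq_zero_iff, map_sub, map_pow, FiniteField.pow_card, sub_self]
    have h2 : (Fintype.card κ : O) = 0 := by
      have h3 : (Fintype.card κ : k) = 0 := by
        apply (algebraMap k κ).injective
        rw [map_natCast, FiniteField.cast_card_eq_zero, map_zero]
      simpa using congrArg (algebraMap k O) h3
    have h3 := hm _ h1
    rw [map_sub, Derivation.leibniz_pow, ← Nat.cast_smul_eq_nsmul O, h2, zero_smul, zero_sub] at h3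
    simpa using neg_mem h3
  have htop : (⊤ : Submodule O (Ω[O⁄k])) ≤ N ⊔ m • ⊤ := by
    rw [← KaehlerDifferential.span_range_derivation k O, Submodule.span_le]
    rintro _ ⟨t, rfl⟩
    exact KaehlerDifferential.span_range_derivation k O ▸ hall t
  exact top_le_iff.mp (Submodule.le_of_le_smul_of_le_jacobson_bot Module.Finite.fg_top
    (IsLocalRing.maximalIdeal_le_jacobson _) htop)

/-- The generators of the maximal ideal still generate the differentials of `O` inside `Ω_{K/k}`. -/
theorem D_algebraMap_mem_span (k O K : Type*) [Field k] [CommRing O]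
    [IsLocalRing O] [Algebra k O] [Module.Finite O (Ω[O⁄k])]
    [Finite k] [Finite (IsLocalRing.ResidueField O)] [Field K] [Algebra O K] [Algebra k K]
    [IsScalarTower k O K] {ι : Type*} (x : ι → O)
    (hx : Ideal.span (Set.range x) = IsLocalRing.maximalIdeal O) (t : O) :
    KaehlerDifferential.D k K (algebraMap O K t) ∈
      Submodule.span O (Set.range fun i => KaehlerDifferential.D k K (algebraMap O K (x i))) := by
  have h : KaehlerDifferential.D k O t ∈ _ :=
    span_D_eq_top_of_span_eq_maximalIdeal k O x hx ▸ Submodule.mem_top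
  have := Submodule.mem_map_of_mem (f := KaehlerDifferential.map k k O K) h
  rw [Submodule.map_span, ← Set.range_comp] at this
  simpa [Function.comp_def] using this

/-- If every element of `O'` is a fraction `a / s` with `a, s ∈ O` and `s` invertible in `O'`, then
generators of the differentials of `O` generate the differentials of `O'`. -/
theorem D_mem_span_of_fraction {k O O' K ι : Type*} [Field k] [CommRing O] [CommRing O'] [Field K]
    [Algebra k K] [Algebra O K] [Algebra O' K] (v : ι → Ω[K⁄k])
    (hO : ∀ t : O, KaehlerDifferential.D k K (algebraMap O K t) ∈
      Submodule.span O (Set.range v))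
    (hOO' : (algebraMap O K).range ≤ (algebraMap O' K).range) (t : O') (a s : O)
    (s' : O') (hs : algebraMap O' K s' * algebraMap O K s = 1)
    (hts : algebraMap O' K t * algebraMap O K s = algebraMap O K a) :
    KaehlerDifferential.D k K (algebraMap O' K t) ∈ Submodule.span O' (Set.range v) := by
  have hO' : ∀ t : O, KaehlerDifferential.D k K (algebraMap O K t) ∈
      Submodule.span O' (Set.range v) := by
    intro t
    refine Submodule.span_induction (p := fun w _ => w ∈ Submodule.span O' (Set.range v))
      (fun w hw => Submodule.subset_span hw) (zero_mem _) (fun _ _ _ _ => add_mem) ?_ (hO t)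
    intro c w _ hw
    obtain ⟨c', hc'⟩ := hOO' ⟨c, rfl⟩
    rw [← algebraMap_smul K c w, ← hc', algebraMap_smul]
    exact Submodule.smul_mem _ _ hw
  have h := congrArg (KaehlerDifferential.D k K) hts
  rw [Derivation.leibniz] at h
  have h2 := congrArg (algebraMap O' K s' • ·) (eq_sub_of_add_eq' h)
  simp only [smul_smul, hs, one_smul] at h2
  rw [h2, algebraMap_smul, algebraMap_smul]
  exact Submodule.smul_mem _ _ (sub_mem (hO' a) (Submodule.smul_mem _ _ (hO' s)))

theorem finrank_kaehlerDifferential_fractionRing (k A K : Type*) [Field k] [CommRing A] [IsDomain A]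
    [Algebra k A] (r : ℕ) [Algebra.IsStandardSmoothOfRelativeDimension r k A] [Field K]
    [Algebra A K] [Algebra k K] [IsScalarTower k A K] [IsFractionRing A K] :
    Module.finrank K (Ω[K⁄k]) = r := by
  have := Algebra.IsStandardSmoothOfRelativeDimension.isStandardSmooth (R := k) (S := A) r
  have hr := Algebra.IsStandardSmoothOfRelativeDimension.rank_kaehlerDifferential (R := k) (S := A) r
  have hr' : Module.finrank A (Ω[A⁄k]) = r := Module.finrank_eq_of_rank_eq hr
  let b := (Module.finBasisOfFinrankEq A (Ω[A⁄k]) hr').ofIsLocalizedModule K (nonZeroDivisors A)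
    (KaehlerDifferential.map k k A K)
  simpa using Module.finrank_eq_card_basis b

theorem basis_of_span {K M : Type*} [Field K] [AddCommGroup M] [Module K M] {r : ℕ}
    (hM : Module.finrank K M = r) (v : Fin r → M) (hv : Submodule.span K (Set.range v) = ⊤) :
    ∃ b : Module.Basis (Fin r) K M, ⇑b = v :=
  ⟨Module.Basis.mk (linearIndependent_of_top_le_span_of_card_eq_finrank hv.ge (by simp [hM])) hv.ge,
    by simp⟩

/-- An alternating form in `r` variables multiplies by a determinant under a linear substitution;
for coefficients in `S` the determinant lies in `S`. -/
theorem map_mem_span_of_mem_span {S K M N : Type*} [CommRing S] [Field K] [Algebra S K] [AddCommGroup M]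
    [Module K M] [Module S M] [IsScalarTower S K M] [AddCommGroup N] [Module K N] {r : ℕ}
    [Module S N] [IsScalarTower S K N] (f : M [⋀^Fin r]→ₗ[K] N)
    (e v : Fin r → M) (hv : ∀ i, v i ∈ Submodule.span S (Set.range e)) :
    f v ∈ Submodule.span S {f e} := by
  simp only [Submodule.mem_span_range_iff_exists_fun] at hv
  choose c hc using hv
  obtain rfl : (fun i => ∑ j, c i j • e j) = v := funext hc
  change f.toMultilinearMap.restrictScalars S _ ∈ _
  rw [MultilinearMap.map_sum]
  refine sum_mem fun σ _ => ?_
  rw [MultilinearMap.map_smul_univ]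
  refine Submodule.smul_mem _ _ ?_
  change f (e ∘ σ) ∈ _
  by_cases hσ : Function.Injective σ
  · rw [show e ∘ σ = e ∘ Equiv.ofBijective σ (Finite.injective_iff_bijective.mp hσ) from rfl,
      f.map_perm]
    obtain h | h := Int.units_eq_one_or
      (Equiv.Perm.sign (Equiv.ofBijective σ (Finite.injective_iff_bijective.mp hσ))) <;> rw [h]
    · simp
    · simp
  · obtain ⟨i, j, hij, hne⟩ : ∃ i j, σ i = σ j ∧ i ≠ j := by
      simpa [Function.Injective] using hσ
    rw [f.map_eq_zero_of_eq (e ∘ σ) (by simp [hij]) hne]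
    exact zero_mem _

theorem exists_smul_ιMulti_basis {K M : Type*} [Field K] [AddCommGroup M] [Module K M] {r : ℕ}
    (b : Module.Basis (Fin r) K M) (w : ⋀[K]^r M) :
    ∃ g : K, w = g • exteriorPower.ιMulti K r b := by
  have hw : w ∈ Submodule.span K (Set.range (exteriorPower.ιMulti K r (M := M))) := by
    rw [exteriorPower.ιMulti_span]; trivial
  have hle : Submodule.span K (Set.range (exteriorPower.ιMulti K r (M := M))) ≤
      Submodule.span K {exteriorPower.ιMulti K r b} := by
    rw [Submodule.span_le]
    rintro _ ⟨v, rfl⟩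
    exact map_mem_span_of_mem_span _ _ _ fun i => by rw [b.span_eq]; trivial
  obtain ⟨g, hg⟩ := Submodule.mem_span_singleton.mp (hle hw)
  exact ⟨g, hg.symm⟩

theorem ιMulti_basis_ne_zero {K M : Type*} [Field K] [AddCommGroup M] [Module K M] {r : ℕ}
    (b : Module.Basis (Fin r) K M) : exteriorPower.ιMulti K r b ≠ 0 := by
  intro h
  have := congrArg (exteriorPower.alternatingMapLinearEquiv b.det) h
  rw [exteriorPower.alternatingMapLinearEquiv_apply_ιMulti, b.det_self, map_zero] at this
  exact one_ne_zero this

theorem coeff_eq_zero_of_mem_span_X_pow {κ : Type*} [CommRing κ] {r a : ℕ} (n : Fin r →₀ ℕ)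
    (hn : ∀ j, n j < a) {F : MvPowerSeries (Fin r) κ}
    (hF : F ∈ Ideal.span (Set.range fun j : Fin r => (MvPowerSeries.X j ^ a))) :
    MvPowerSeries.coeff n F = 0 := by
  obtain ⟨c, rfl⟩ := Ideal.mem_span_range_iff_exists_fun.mp hF
  rw [map_sum]
  exact Finset.sum_eq_zero fun j _ => MvPowerSeries.X_pow_dvd_iff.mp (dvd_mul_left _ _) n (hn j)

/-- If `F ≡ c x₁^(a-1) ⋯ x_r^(a-1)` modulo `(x₁^a, …, x_r^a)`, multiplication of `F` by a power
series `U` only depends on the constant term of `U`, as far as the coefficient of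
`x₁^(a-1) ⋯ x_r^(a-1)` is concerned. -/
theorem coeff_mul_of_sub_mem_span_X_pow {κ : Type*} [CommRing κ] {r a : ℕ} (ha : 0 < a) (c : κ)
    (F U : MvPowerSeries (Fin r) κ)
    (hF : F - MvPowerSeries.C c * ∏ j, MvPowerSeries.X j ^ (a - 1) ∈
      Ideal.span (Set.range fun j : Fin r => (MvPowerSeries.X j ^ a : MvPowerSeries (Fin r) κ))) :
    MvPowerSeries.coeff (Finsupp.equivFunOnFinite.symm fun _ => a - 1) (F * U) =
      c * MvPowerSeries.constantCoeff U := by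
  set n : Fin r →₀ ℕ := Finsupp.equivFunOnFinite.symm fun _ => a - 1 with hn
  have h0 := coeff_eq_zero_of_mem_span_X_pow n (fun j => by simp [hn]; omega)
    (Ideal.mul_mem_right U _ hF)
  have hmon : (∏ j, MvPowerSeries.X j ^ (a - 1) : MvPowerSeries (Fin r) κ) =
      MvPowerSeries.monomial n 1 := by
    rw [MvPowerSeries.monomial_eq', map_one, one_mul, Finsupp.prod_fintype _ _ (by simp)]
    simp [hn]
  rw [sub_mul, map_sub, sub_eq_zero] at h0
  rw [h0, mul_assoc, MvPowerSeries.coeff_C_mul, hmon]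
  have := MvPowerSeries.coeff_add_monomial_mul n 0 U (1 : κ)
  rw [add_zero] at this
  rw [this, one_mul, MvPowerSeries.coeff_zero_eq_constantCoeff_apply]

end CommutativeAlgebra

/-! ### Germs and rational functions -/

noncomputable section Geometry

section Stalks

variable {X : Scheme.{u}} [IsIntegral X]

theorem range_algebraMap_stalk_le {P Q : X} (h : Q ⤳ P) :
    (algebraMap (X.presheaf.stalk P) X.functionField).range ≤
      (algebraMap (X.presheaf.stalk Q) X.functionField).range := by
  rintro _ ⟨t, rfl⟩
  refine ⟨X.presheaf.stalkSpecializes h t, ?_⟩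
  simp_rw [RingHom.algebraMap_toAlgebra]
  rw [← CommRingCat.comp_apply, X.presheaf.stalkSpecializes_comp]

/-- If `Q` is a generization of `P`, every germ at `Q` is a fraction of germs at `P` with
denominator invertible at `Q`. -/
theorem exists_fraction_of_specializes {P Q : X} (h : Q ⤳ P) (t : X.presheaf.stalk Q) :
    ∃ (a s : X.presheaf.stalk P) (s' : X.presheaf.stalk Q),
      algebraMap _ X.functionField s' * algebraMap _ X.functionField s = 1 ∧
      algebraMap _ X.functionField t * algebraMap _ X.functionField s =
        algebraMap _ X.functionField a := by
  obtain ⟨_, ⟨V, hV, rfl⟩, hP, -⟩ :=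
    X.isBasis_affineOpens.exists_subset_of_mem_open (Set.mem_univ P) isOpen_univ
  have hQ : Q ∈ V := h.mem_open V.2 hP
  have : Nonempty V := ⟨⟨P, hP⟩⟩
  let := X.presheaf.algebra_section_stalk ⟨Q, hQ⟩
  have := hV.isLocalization_stalk ⟨Q, hQ⟩
  obtain ⟨⟨a, s⟩, has⟩ := IsLocalization.surj (hV.primeIdealOf ⟨Q, hQ⟩).asIdeal.primeCompl t
  obtain ⟨u, hu⟩ := IsLocalization.map_units (X.presheaf.stalk Q) s
  have hgerm (b : Γ(X, V)) : algebraMap (X.presheaf.stalk P) X.functionField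
      (X.presheaf.germ V P hP b) = algebraMap (X.presheaf.stalk Q) X.functionField
      (algebraMap Γ(X, V) (X.presheaf.stalk Q) b) := by
    refine (Scheme.algebraMap_germ_eq_germToFunctionField X hP b).trans ?_
    exact (Scheme.algebraMap_germ_eq_germToFunctionField X hQ b).symm
  refine ⟨X.presheaf.germ V P hP a, X.presheaf.germ V P hP s, ↑u⁻¹, ?_, ?_⟩
  · rw [hgerm, ← hu, ← map_mul, Units.inv_mul, map_one]
  · rw [hgerm, hgerm, ← map_mul]
    exact congrArg _ has

variable [IsLocallyNoetherian X]

/-- At a normal point `P`, a rational function is regular as soon as it is regular at the prime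
divisors through `P`. -/
theorem mem_range_stalk_of_forall_primeDivisor {P : X}
    [IsIntegrallyClosed (X.presheaf.stalk P)] (y : X.functionField)
    (hy : ∀ Z : PrimeDivisor X, Z.1 ⤳ P →
      y ∈ (algebraMap (X.presheaf.stalk Z.1) X.functionField).range) :
    y ∈ (algebraMap (X.presheaf.stalk P) X.functionField).range := by
  obtain ⟨_, ⟨V, hV, rfl⟩, hP, -⟩ :=
    X.isBasis_affineOpens.exists_subset_of_mem_open (Set.mem_univ P) isOpen_univ
  have : Nonempty V := ⟨⟨P, hP⟩⟩
  let := X.presheaf.algebra_section_stalk ⟨P, hP⟩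
  have := hV.isLocalization_stalk ⟨P, hP⟩
  have := functionField_isScalarTower X V ⟨P, hP⟩
  set p := (hV.primeIdealOf ⟨P, hP⟩).asIdeal with hp
  refine mem_range_of_forall_height_one y fun q _ hq => ?_
  let q' : PrimeSpectrum Γ(X, V) := ⟨q.under Γ(X, V), inferInstance⟩
  have hq'p : q'.asIdeal ≤ p := by
    have := (IsLocalization.AtPrime.orderIsoOfPrime (X.presheaf.stalk P) p ⟨q, inferInstance⟩).2.2
    exact this
  let Z : X := hV.fromSpec q'
  have hZP : Z ⤳ P := by
    have : hV.fromSpec (hV.primeIdealOf ⟨P, hP⟩) = P := hV.fromSpec_primeIdealOf ⟨P, hP⟩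
    rw [← this]
    exact ((PrimeSpectrum.le_iff_specializes q' _).mp hq'p).map hV.fromSpec.continuous
  have hZV : Z ∈ V := hZP.mem_open V.2 hP
  let := X.presheaf.algebra_section_stalk ⟨Z, hZV⟩
  have hlocZ : IsLocalization.AtPrime (X.presheaf.stalk Z) q'.asIdeal :=
    hV.isLocalization_stalk' q' hZV
  have := functionField_isScalarTower X V ⟨Z, hZV⟩
  have hZ : Order.coheight Z = 1 := by
    have h1 := ringKrullDim_stalk_eq_coheight Z
    rw [IsLocalization.AtPrime.ringKrullDim_eq_height q'.asIdeal,
      IsLocalization.height_under p.primeCompl, hq] at h1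
    exact_mod_cast h1.symm
  obtain ⟨t, rfl⟩ := hy ⟨Z, hZ⟩ hZP
  obtain ⟨⟨a, s⟩, has⟩ := IsLocalization.surj q'.asIdeal.primeCompl t
  refine ⟨algebraMap _ _ s.1, s.2, algebraMap Γ(X, V) (X.presheaf.stalk P) a, ?_⟩
  rw [← IsScalarTower.algebraMap_apply, ← IsScalarTower.algebraMap_apply,
    IsScalarTower.algebraMap_apply Γ(X, V) (X.presheaf.stalk Z), ← has, map_mul, mul_comm,
    ← IsScalarTower.algebraMap_apply]

/-- At a normal prime divisor, rational functions of nonnegative order are regular. -/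
theorem mem_range_stalk_of_ord_nonneg {Z : X} (hZ : Order.coheight Z = 1)
    [IsIntegrallyClosed (X.presheaf.stalk Z)] {g : X.functionField} (hg : g ≠ 0)
    (h : 0 ≤ X.ord g Z) : g ∈ (algebraMap (X.presheaf.stalk Z) X.functionField).range := by
  have hdim : Ring.KrullDimLE 1 (X.presheaf.stalk Z) := krullDimLE_of_coheight_le hZ.le
  have htfae : (IsIntegrallyClosed (X.presheaf.stalk Z) ∧ ∀ P : Ideal (X.presheaf.stalk Z), P ≠ ⊥ →
      P.IsPrime → P = IsLocalRing.maximalIdeal _) ↔ ValuationRing (X.presheaf.stalk Z) :=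
    (tfae_of_isNoetherianRing_of_isLocalRing_of_isDomain (X.presheaf.stalk Z)).out 3 1
  have : ValuationRing (X.presheaf.stalk Z) := htfae.mp
    ⟨inferInstance, fun P hP hP' => IsLocalRing.eq_maximalIdeal (hP'.isMaximal_of_ne_bot hP)⟩
  by_contra hng
  obtain ⟨b, hb⟩ : ∃ b : X.presheaf.stalk Z, algebraMap _ X.functionField b = g⁻¹ :=
    ((ValuationRing.isInteger_or_isInteger (X.presheaf.stalk Z) g).resolve_left hng)
  have hb0 : b ≠ 0 := by
    rintro rfl
    exact inv_ne_zero hg (by rw [← hb, map_zero])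
  have hbu : ¬ IsUnit b := by
    rintro ⟨v, rfl⟩
    refine hng ⟨↑v⁻¹, ?_⟩
    rw [← inv_inv g, ← hb]
    exact eq_inv_of_mul_eq_one_left (by rw [← map_mul, Units.inv_mul, map_one])
  have hord : X.ord g Z + X.ord (g⁻¹) Z = 0 := by
    rw [← Scheme.ord_mul hg (inv_ne_zero hg), mul_inv_cancel₀ hg, Scheme.ord_eq_iff hZ one_ne_zero]
    simp
  have hpos : 1 ≤ X.ord (g⁻¹) Z := by
    rw [Scheme.le_ord_iff hZ (inv_ne_zero hg), ← hb]
    change _ ≤ Ring.ordFrac (X.presheaf.stalk Z) (algebraMap _ X.functionField b)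
    have hbz := mem_nonZeroDivisors_of_ne_zero hb0
    rw [Ring.ordFrac_eq_ord _ hb0]
    obtain ⟨n, hn⟩ := ENat.ne_top_iff_exists.mp (Ring.ord_ne_top hbz)
    rw [Ring.ordMonoidWithZeroHom_eq_coe _ hbz hn.symm, WithZero.coe_le_coe,
      Multiplicative.ofAdd_le]
    have hn0 : n ≠ 0 := by
      rintro rfl
      have h0 : Ring.ord (X.presheaf.stalk Z) b = 0 := hn.symm
      rw [Ring.ord, Module.length_eq_zero_iff, Ideal.Quotient.subsingleton_iff,
        Ideal.span_singleton_eq_top] at h0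
      exact hbu h0
    omega
  omega

theorem ord_algebraMap_of_isUnit {Z : X} (hZ : Order.coheight Z = 1) {u : X.presheaf.stalk Z}
    (hu : IsUnit u) : X.ord (algebraMap _ X.functionField u) Z = 0 := by
  have hdim : Ring.KrullDimLE 1 (X.presheaf.stalk Z) := krullDimLE_of_coheight_le hZ.le
  rw [Scheme.ord_eq_iff hZ (hu.map _).ne_zero]
  exact Ring.ordFrac_of_isUnit hu

theorem ord_prod {ι : Type*} (s : Finset ι) {f : ι → X.functionField} (hf : ∀ i, f i ≠ 0) (Z : X) :
    X.ord (∏ i ∈ s, f i) Z = ∑ i ∈ s, X.ord (f i) Z := by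
  classical
  induction s using Finset.induction_on with
  | empty =>
    have := Scheme.ord_mul (X := X) (x := Z) one_ne_zero one_ne_zero
    simpa using this
  | insert i s hi ih =>
    rw [Finset.prod_insert hi, Finset.sum_insert hi,
      Scheme.ord_mul (hf i) (Finset.prod_ne_zero_iff.mpr fun j _ => hf j), ih]

end Stalks

/-! ### Smooth schemes over a field -/

section Smooth

variable (k : Type u) [Field k] {X : Scheme.{u}} [X.Over (Spec (.of k))]

/-- The sections of a `k`-scheme over an open set form a `k`-algebra through the structure
morphism. -/
abbrev sectionsAlgebra (V : X.Opens) : Algebra k Γ(X, V) :=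
  ((Scheme.ΓSpecIso (.of k)).inv ≫ (X ↘ Spec (.of k)).appTop ≫
    X.presheaf.map (homOfLE le_top).op).hom.toAlgebra

/-- Every point of a smooth scheme of relative dimension `r` over a field has an affine neighbourhood
whose ring of sections is standard smooth of relative dimension `r` over the field. -/
theorem exists_affine_isStandardSmooth (r : ℕ) [SmoothOfRelativeDimension r (X ↘ Spec (.of k))]
    (P : X) : ∃ V : X.Opens, IsAffineOpen V ∧ P ∈ V ∧
      letI := sectionsAlgebra k V
      Algebra.IsStandardSmoothOfRelativeDimension r k Γ(X, V) := by
  obtain ⟨U, hU, V, hV, hP, e, hf⟩ :=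
    SmoothOfRelativeDimension.exists_isStandardSmoothOfRelativeDimension
      (n := r) (f := X ↘ Spec (.of k)) P
  refine ⟨V, hV, hP, ?_⟩
  -- the spectrum of a field is a single point
  have hUtop : U = ⊤ := by
    refine SetLike.coe_injective (Set.eq_univ_of_forall fun y => ?_)
    rw [Subsingleton.elim y ((X ↘ Spec (.of k)) P)]
    exact e hP
  subst hUtop
  have h := (RingHom.isStandardSmoothOfRelativeDimension_respectsIso (n := r)).2 _
    (Scheme.ΓSpecIso (.of k)).symm.commRingCatIsoToRingEquiv hf
  let := sectionsAlgebra k V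
  rw [← RingHom.isStandardSmoothOfRelativeDimension_algebraMap]
  exact h

theorem isScalarTower_sections_stalk (V : X.Opens) (P : X) (hP : P ∈ V) :
    letI := sectionsAlgebra k V
    letI := X.presheaf.algebra_section_stalk ⟨P, hP⟩
    IsScalarTower k Γ(X, V) (X.presheaf.stalk P) := by
  let := sectionsAlgebra k V
  let := X.presheaf.algebra_section_stalk ⟨P, hP⟩
  apply IsScalarTower.of_algebraMap_eq'
  change _ = (((Scheme.ΓSpecIso (.of k)).inv ≫ (X ↘ Spec (.of k)).appTop ≫
    X.presheaf.map (homOfLE le_top).op) ≫ X.presheaf.germ V P hP).hom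
  rw [Category.assoc, Category.assoc, X.presheaf.germ_res]
  rfl

/-- A point of codimension `r` on a smooth scheme of relative dimension `r` is closed, so its residue
field is finite over the base field. -/
theorem finite_resField [Finite k] (r : ℕ) [SmoothOfRelativeDimension r (X ↘ Spec (.of k))] (P : X)
    (hP : Order.coheight P = (r : ℕ∞)) : Finite (ResField P) := by
  obtain ⟨V, hV, hPV, hsm⟩ := exists_affine_isStandardSmooth k r P
  let := sectionsAlgebra k V
  let := X.presheaf.algebra_section_stalk ⟨P, hPV⟩
  have := hV.isLocalization_stalk ⟨P, hPV⟩
  have := Algebra.IsStandardSmoothOfRelativeDimension.isStandardSmooth (R := k) (S := Γ(X, V)) r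
  set p := (hV.primeIdealOf ⟨P, hPV⟩).asIdeal
  have hp : p.height = r := by
    have h1 := ringKrullDim_stalk_eq_coheight P
    rw [IsLocalization.AtPrime.ringKrullDim_eq_height p, hP] at h1
    exact_mod_cast h1
  have := isMaximal_of_height_eq k Γ(X, V) r p hp
  have := finite_quotient_of_isMaximal k Γ(X, V) p
  exact Finite.of_equiv _ (IsLocalization.AtPrime.equivQuotMaximalIdeal p
    (X.presheaf.stalk P)).toEquiv

theorem finite_kaehlerDifferential_stalk (r : ℕ)
    [SmoothOfRelativeDimension r (X ↘ Spec (.of k))] (P : X) :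
    Module.Finite (X.presheaf.stalk P) (Ω[X.presheaf.stalk P⁄k]) := by
  obtain ⟨V, hV, hP, hsm⟩ := exists_affine_isStandardSmooth k r P
  let := sectionsAlgebra k V
  let := X.presheaf.algebra_section_stalk ⟨P, hP⟩
  have := hV.isLocalization_stalk ⟨P, hP⟩
  have := isScalarTower_sections_stalk k V P hP
  have := Algebra.IsStandardSmoothOfRelativeDimension.isStandardSmooth (R := k) (S := Γ(X, V)) r
  have : Algebra.EssFiniteType Γ(X, V) (X.presheaf.stalk P) :=
    .of_isLocalization _ (hV.primeIdealOf ⟨P, hP⟩).asIdeal.primeCompl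
  have : Algebra.EssFiniteType k (X.presheaf.stalk P) := .comp k Γ(X, V) _
  infer_instance

variable [IsIntegral X]

/-- Smooth schemes over a field are normal. -/
theorem isIntegrallyClosed_stalk (r : ℕ) [SmoothOfRelativeDimension r (X ↘ Spec (.of k))] (P : X) :
    IsIntegrallyClosed (X.presheaf.stalk P) := by
  obtain ⟨V, hV, hP, hsm⟩ := exists_affine_isStandardSmooth k r P
  have : Nonempty V := ⟨⟨P, hP⟩⟩
  let := sectionsAlgebra k V
  let := X.presheaf.algebra_section_stalk ⟨P, hP⟩
  have := hV.isLocalization_stalk ⟨P, hP⟩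
  obtain ⟨g, hg⟩ :=
    Algebra.IsStandardSmoothOfRelativeDimension.exists_etale_mvPolynomial r k Γ(X, V)
  algebraize [g.toRingHom]
  have := isIntegrallyClosed_of_etale (MvPolynomial (Fin r) k) Γ(X, V)
  exact isIntegrallyClosed_of_isLocalization (X.presheaf.stalk P)
    (hV.primeIdealOf ⟨P, hP⟩).asIdeal.primeCompl (Ideal.primeCompl_le_nonZeroDivisors _)

theorem finrank_kaehlerDifferential_functionField (r : ℕ)
    [SmoothOfRelativeDimension r (X ↘ Spec (.of k))] :
    Module.finrank X.functionField (Ω[X.functionField⁄k]) = r := by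
  obtain ⟨V, hV, hP, hsm⟩ := exists_affine_isStandardSmooth k r (genericPoint X)
  have : Nonempty V := ⟨⟨_, hP⟩⟩
  let := sectionsAlgebra k V
  have := functionField_isFractionRing_of_isAffineOpen X V hV
  have : IsScalarTower k Γ(X, V) X.functionField := isScalarTower_sections_stalk k V _ hP
  exact finrank_kaehlerDifferential_fractionRing k Γ(X, V) X.functionField r

end Smooth

end Geometry

/-! ### Local coordinates and regular forms -/

noncomputable section Frames

variable {k : Type u} [Field k] {X : Scheme.{u}} [X.Over (Spec (.of k))] [IsIntegral X]

theorem smul_eq_algebraMap_smul_form {r : ℕ} {P : X} (g : X.presheaf.stalk P)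
    (η : RationalForm k X r) : g • η = algebraMap _ X.functionField g • η :=
  (algebraMap_smul _ g η).symm

variable [Finite k] {r : ℕ} [SmoothOfRelativeDimension r (X ↘ Spec (.of k))] {P : X}
  (hP : Order.coheight P = (r : ℕ∞)) {x : Fin r → X.presheaf.stalk P}
  (hx : Ideal.span (Set.range x) = IsLocalRing.maximalIdeal (X.presheaf.stalk P))

include hP hx

theorem D_mem_span_of_specializes {Q : X} (hQ : Q ⤳ P) (t : X.presheaf.stalk Q) :
    KaehlerDifferential.D k X.functionField (algebraMap _ X.functionField t) ∈
      Submodule.span (X.presheaf.stalk Q) (Set.range fun i =>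
        KaehlerDifferential.D k X.functionField (algebraMap _ X.functionField (x i))) := by
  have := finite_resField k r P hP
  have := finite_kaehlerDifferential_stalk k r P
  obtain ⟨a, s, s', h1, h2⟩ := exists_fraction_of_specializes hQ t
  exact D_mem_span_of_fraction _ (D_algebraMap_mem_span k (X.presheaf.stalk P) X.functionField x hx)
    (range_algebraMap_stalk_le hQ) t a s s' h1 h2

theorem exists_basis_D : ∃ b : Module.Basis (Fin r) X.functionField (Ω[X.functionField⁄k]),
    ⇑b = fun i => KaehlerDifferential.D k X.functionField (algebraMap _ X.functionField (x i)) := by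
  refine basis_of_span (finrank_kaehlerDifferential_functionField k r) _ (top_le_iff.mp ?_)
  rw [← KaehlerDifferential.span_range_derivation k X.functionField, Submodule.span_le]
  rintro _ ⟨t, rfl⟩
  obtain ⟨a, s, hs, rfl⟩ := IsFractionRing.div_surjective (A := X.presheaf.stalk P) t
  have hs0 : algebraMap _ X.functionField s ≠ 0 := by simpa using nonZeroDivisors.ne_zero hs
  have := finite_resField k r P hP
  have := finite_kaehlerDifferential_stalk k r P
  exact D_mem_span_of_fraction (O := X.presheaf.stalk P) (O' := X.functionField)
    (K := X.functionField) _
    (D_algebraMap_mem_span k (X.presheaf.stalk P) X.functionField x hx)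
    (fun y _ => ⟨y, rfl⟩) _ a s (algebraMap _ X.functionField s)⁻¹
    (inv_mul_cancel₀ hs0) (div_mul_cancel₀ _ hs0)

/-- `dx₁ ∧ ⋯ ∧ dx_r` does not vanish. -/
theorem wedge_ne_zero : wedge k x ≠ 0 := by
  obtain ⟨b, hb⟩ := exists_basis_D (k := k) hP hx
  rw [wedge, ← hb]
  exact ιMulti_basis_ne_zero b

theorem exists_eq_smul_wedge (ω : RationalForm k X r) :
    ∃ g : X.functionField, ω = g • wedge k x := by
  obtain ⟨b, hb⟩ := exists_basis_D (k := k) hP hx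
  rw [wedge, ← hb]
  exact exists_smul_ιMulti_basis b ω

/-- Generators `x₁, …, x_r` of `m_P` are local coordinates near `P`: the form `dx₁ ∧ ⋯ ∧ dx_r`
generates the regular `r`-forms at every generization of `P`. -/
theorem regularForms_eq_span_wedge {Q : X} (hQ : Q ⤳ P) :
    regularForms k r Q = Submodule.span (X.presheaf.stalk Q) {wedge k x} := by
  refine le_antisymm (Submodule.span_le.mpr ?_) (Submodule.span_le.mpr ?_)
  · rintro _ ⟨t, rfl⟩
    exact map_mem_span_of_mem_span (exteriorPower.ιMulti X.functionField r) _ _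
      fun i => D_mem_span_of_specializes hP hx hQ (t i)
  · rintro _ rfl
    choose t ht using fun i => range_algebraMap_stalk_le hQ ⟨x i, rfl⟩
    refine Submodule.subset_span ⟨t, ?_⟩
    simp only [wedge, ht]

theorem formCoeff_smul_wedge (g : X.presheaf.stalk P) : formCoeff k x (g • wedge k x) = g := by
  have h : ∃ g' : X.presheaf.stalk P, g • wedge k x = g' • wedge k x := ⟨g, rfl⟩
  rw [formCoeff, dif_pos h]
  have : algebraMap _ X.functionField g • wedge k x =
      algebraMap _ X.functionField h.choose • wedge k x := by
    simpa only [algebraMap_smul] using h.choose_spec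
  exact (IsFractionRing.injective _ X.functionField
    (smul_left_injective _ (wedge_ne_zero (k := k) hP hx) this)).symm

variable [IsLocallyNoetherian X]

/-- Along a prime divisor through `P`, the order of `g dx₁ ∧ ⋯ ∧ dx_r` is the order of `g`. -/
theorem formOrd_smul_wedge (Z : PrimeDivisor X) (hZ : Z.1 ⤳ P) {g : X.functionField} (hg : g ≠ 0) :
    formOrd k (g • wedge k x) Z = X.ord g Z.1 := by
  have h : ∃ (g' : X.functionField) (η : RationalForm k X r),
      regularForms k r Z.1 = Submodule.span (X.presheaf.stalk Z.1) {η} ∧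
        g • wedge k x = g' • η := ⟨g, _, regularForms_eq_span_wedge hP hx hZ, rfl⟩
  rw [formOrd, dif_pos h]
  obtain ⟨η, h1, h2⟩ := h.choose_spec
  set g' := h.choose
  have hw := wedge_ne_zero (k := k) hP hx
  rw [regularForms_eq_span_wedge hP hx hZ] at h1
  obtain ⟨u, hu⟩ := Submodule.mem_span_singleton.mp
    (h1 ▸ Submodule.mem_span_singleton_self (wedge k x) : wedge k x ∈ Submodule.span _ {η})
  obtain ⟨v, hv⟩ := Submodule.mem_span_singleton.mp
    (h1.symm ▸ Submodule.mem_span_singleton_self η : η ∈ Submodule.span _ {wedge k x})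
  rw [smul_eq_algebraMap_smul_form] at hu hv
  -- `u` and `v` are mutually inverse units and `g' v = g`
  have huv : u * v = 1 := by
    apply IsFractionRing.injective _ X.functionField
    apply smul_left_injective _ hw
    simp only [map_mul, mul_smul, hv, hu, map_one, one_smul]
  have hgv : g = g' * algebraMap _ X.functionField v := by
    apply smul_left_injective _ hw
    simp only [mul_smul, hv, h2]
  have hg' : g' ≠ 0 := by
    rintro h0
    exact hg (by rw [hgv, h0, zero_mul])
  have hvu : IsUnit v := IsUnit.of_mul_eq_one u (by rw [mul_comm, huv])
  rw [hgv, Scheme.ord_mul hg' (hvu.map _).ne_zero, ord_algebraMap_of_isUnit Z.2 hvu, add_zero]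

end Frames

/-! ### Residues -/

noncomputable section Residues

section Expansion

variable (k : Type u) [Field k] {X : Scheme.{u}} [X.Over (Spec (.of k))] {r : ℕ} {P : X}
  (x : Fin r → X.presheaf.stalk P)

/-- Multiplicativity also holds, trivially, for the value `0` taken in the absence of an
expansion homomorphism, so no existence statement is needed. -/
theorem expansion_mul (g h : X.presheaf.stalk P) :
    expansion k x (g * h) = expansion k x g * expansion k x h := by
  by_cases hτ : ∃ τ : X.presheaf.stalk P →ₐ[k] MvPowerSeries (Fin r) (ResField P), IsExpansion k x τ
  · simp only [expansion, dif_pos hτ, map_mul]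
  · simp only [expansion, dif_neg hτ, mul_zero]

theorem constantCoeff_expansion_mul (g h : X.presheaf.stalk P) :
    MvPowerSeries.constantCoeff (expansion k x (g * h)) =
      IsLocalRing.residue _ g * MvPowerSeries.constantCoeff (expansion k x h) := by
  by_cases hτ : ∃ τ : X.presheaf.stalk P →ₐ[k] MvPowerSeries (Fin r) (ResField P), IsExpansion k x τ
  · simp only [expansion, dif_pos hτ, map_mul, hτ.choose_spec.2]
  · simp only [expansion, dif_neg hτ, map_zero, mul_zero]

end Expansion

variable {k : Type u} [Field k] {X : Scheme.{u}} [X.Over (Spec (.of k))] [IsIntegral X]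

theorem valueAt_algebraMap {P : X} (g : X.presheaf.stalk P) :
    valueAt (algebraMap _ X.functionField g) P = IsLocalRing.residue _ g := by
  have hh : IsRegularAt (algebraMap _ X.functionField g) P := ⟨g, rfl⟩
  rw [valueAt, dif_pos hh]
  exact congrArg _ (IsFractionRing.injective _ X.functionField hh.choose_spec)

variable [IsLocallyNoetherian X] [Finite k] {r : ℕ}
  [SmoothOfRelativeDimension r (X ↘ Spec (.of k))] {P : X} (hP : Order.coheight P = (r : ℕ∞))
  {D : Fin r → Divisor X}

include hP

/-- The residue of `ω` when `f₁ ⋯ f_r ω = g dx₁ ∧ ⋯ ∧ dx_r`. -/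
theorem residue_eq_trace (c : LocalChoice D P) {ω : RationalForm k X r} {g : X.presheaf.stalk P}
    (hω : (∏ l, c.f l) • ω = g • wedge k c.x) :
    residue k c ω = Algebra.trace k (ResField P)
      (MvPowerSeries.coeff (Finsupp.equivFunOnFinite.symm fun _ => c.a - 1)
        (expansion k c.x (c.R * g))) := by
  rw [residue, systemResidue, residueSymbol, hω, smul_smul, formCoeff_smul_wedge hP c.span_x]

/-- Poles bounded by `D - G - (θ)⁺` with `G ≥ 0` at `P` make `f₁ ⋯ f_r ω` a regular multiple
of `θ dx₁ ∧ ⋯ ∧ dx_r`: the quotient has no pole along any prime divisor through the normal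
point `P`. -/
theorem exists_prod_smul_eq (c : LocalChoice D P) (G : Divisor X)
    (hG : ∀ Z : PrimeDivisor X, Z.1 ⤳ P → 0 ≤ G Z) {t : X.presheaf.stalk P} (ht : t ≠ 0)
    {ω : RationalForm k X r}
    (hω : ω ∈ formsBoundedBy k r fun Z => (∑ l, D l - G) Z -
      divPos (algebraMap _ X.functionField t) Z) :
    ∃ u : X.presheaf.stalk P, (∏ l, c.f l) • ω = (t * u) • wedge k c.x := by
  have := isIntegrallyClosed_stalk k (X := X) r
  obtain ⟨g, rfl⟩ := exists_eq_smul_wedge hP c.span_x ω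
  have hinj := IsFractionRing.injective (X.presheaf.stalk P) X.functionField
  set θ := algebraMap _ X.functionField t with hθdef
  have hθ : θ ≠ 0 := (map_ne_zero_iff _ hinj).mpr ht
  set F := algebraMap _ X.functionField (∏ l, c.f l) with hF
  have hfl (l) : algebraMap _ X.functionField (c.f l) ≠ 0 :=
    (map_ne_zero_iff _ hinj).mpr (c.f_eq l).1
  have hF0 : F ≠ 0 := by
    rw [hF, map_prod]
    exact Finset.prod_ne_zero_iff.mpr fun l _ => hfl l
  have hFord (Z : PrimeDivisor X) (hZ : Z.1 ⤳ P) : X.ord F Z.1 = ∑ l, D l Z := by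
    rw [hF, map_prod, ord_prod _ hfl]
    exact Finset.sum_congr rfl fun l _ => (c.f_eq l).2 Z hZ
  suffices h : F * g / θ ∈ (algebraMap (X.presheaf.stalk P) X.functionField).range by
    obtain ⟨u, hu⟩ := h
    refine ⟨u, ?_⟩
    rw [smul_eq_algebraMap_smul_form, smul_eq_algebraMap_smul_form, map_mul, hu, smul_smul,
      mul_div_cancel₀ _ hθ]
  by_cases hg : g = 0
  · exact ⟨0, by simp [hg]⟩
  refine mem_range_stalk_of_forall_primeDivisor _ fun Z hZ => ?_
  have hy0 : F * g / θ ≠ 0 := div_ne_zero (mul_ne_zero hF0 hg) hθ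
  refine mem_range_stalk_of_ord_nonneg Z.2 hy0 ?_
  have h1 : X.ord (F * g / θ) Z.1 + X.ord θ Z.1 = X.ord F Z.1 + X.ord g Z.1 := by
    rw [← Scheme.ord_mul hy0 hθ, ← Scheme.ord_mul hF0 hg, div_mul_cancel₀ _ hθ]
  have h2 : 0 ≤ X.ord g Z.1 + ((∑ l, D l - G) Z - divPos θ Z) := by
    rcases hω with h | h
    · exact absurd h (smul_ne_zero hg (wedge_ne_zero hP c.span_x))
    · rw [← formOrd_smul_wedge (k := k) hP c.span_x Z hZ hg]
      exact h Z
  have h3 : X.ord θ Z.1 ≤ divPos θ Z := le_max_left _ _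
  rw [Finsupp.sub_apply, Finsupp.finsetSum_apply] at h2
  rw [hFord Z hZ] at h1
  linarith [hG Z hZ]

end Residues

end ResidueCode

open ResidueCode in
theorem proposition4p3 {k : Type u} [Field k] [Finite k] {r : ℕ}
    (X : SmoothProjectiveVariety k r)
    (Ps : Finset X.toScheme) (hPs : ∀ P ∈ Ps, IsRationalPoint k P)
    (G : Divisor X.toScheme) (hG : ∀ P ∈ Ps, P ∉ Supp G)
    (D : Fin r → Divisor X.toScheme) (hD : ∀ l, 0 ≤ D l) (hDprop : IntersectProperly D)
    (hPsD : ∀ P ∈ Ps, P ∈ inter D)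
    (𝒸 : ∀ P ∈ inter D, LocalChoice D P)
    (θ : X.toScheme.functionField) (hθ : θ ≠ 0) (hθrect : IsRectifying k 𝒸 Ps θ)
    (h : X.toScheme.functionField) (hh : ∀ P ∈ inter D, IsRegularAt h P)
    (ω : RationalForm k X.toScheme r)
    (hω : ω ∈ formsBoundedBy k r fun Z => (∑ l, D l - G) Z - divPos θ Z)
    (P : X.toScheme) (hP : P ∈ inter D)
    (hGP : P ∉ Ps → ∀ Z : PrimeDivisor X.toScheme, Z.1 ⤳ P → 0 ≤ G Z) :
    (HasResidue k (𝒸 P hP) ω ∧ HasResidue k (𝒸 P hP) (h • ω)) ∧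
    algebraMap k (ResField P) (residue k (𝒸 P hP) (h • ω)) =
      valueAt h P * algebraMap k (ResField P) (residue k (𝒸 P hP) ω) ∧
    (P ∉ Ps → residue k (𝒸 P hP) ω = 0) := by
  have : SmoothOfRelativeDimension r (X.toScheme ↘ Spec (.of k)) := X.smooth
  have hht := hDprop P hP
  have hG' : ∀ Z : PrimeDivisor X.toScheme, Z.1 ⤳ P → 0 ≤ G Z := by
    intro Z hZ
    by_cases hPP : P ∈ Ps
    · by_contra! hneg
      exact hG P hPP ⟨Z, hneg.ne, hZ⟩
    · exact hGP hPP Z hZ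
  set c := 𝒸 P hP
  obtain ⟨t, rfl, hin, hout⟩ := hθrect P hP
  obtain ⟨h', rfl⟩ := hh P hP
  have ht : t ≠ 0 := by rintro rfl; exact hθ (map_zero _)
  obtain ⟨u, hu⟩ := exists_prod_smul_eq hht c G hG' ht hω
  have hu' : (∏ l, c.f l) • algebraMap _ X.toScheme.functionField h' • ω =
      (t * (h' * u)) • wedge k c.x := by
    rw [algebraMap_smul, smul_comm, hu, smul_smul, mul_left_comm]
  have hreg (g : X.toScheme.presheaf.stalk P) : g • wedge k c.x ∈ regularForms k r P :=
    Submodule.smul_mem _ _ (Submodule.subset_span ⟨c.x, rfl⟩)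
  -- as `θ` is rectifying, only the value of `v` at `P` enters the coefficient of `x^(a-1)` in `R θ v`
  have hcoeff (b : k) (hb : expansion k c.x (c.R * t) -
      MvPowerSeries.C (algebraMap k (ResField P) b) * ∏ j, MvPowerSeries.X j ^ (c.a - 1) ∈
        Ideal.span (Set.range fun j : Fin r =>
          (MvPowerSeries.X j ^ c.a : MvPowerSeries (Fin r) (ResField P))))
      (v : X.toScheme.presheaf.stalk P) :
      MvPowerSeries.coeff (Finsupp.equivFunOnFinite.symm fun _ => c.a - 1)
        (expansion k c.x (c.R * (t * v))) =
      algebraMap k (ResField P) b * MvPowerSeries.constantCoeff (expansion k c.x v) := by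
    rw [← mul_assoc, expansion_mul]
    exact coeff_mul_of_sub_mem_span_X_pow c.a_pos _ _ _ hb
  refine ⟨⟨?_, ?_⟩, ?_⟩
  · rw [HasResidue, hu]
    exact hreg _
  · rw [HasResidue, hu']
    exact hreg _
  rw [residue_eq_trace hht c hu', residue_eq_trace hht c hu, valueAt_algebraMap]
  by_cases hPP : P ∈ Ps
  · refine ⟨?_, fun hn => absurd hPP hn⟩
    obtain ⟨b, hb⟩ := hin hPP
    -- over the rational point `P` the trace is the identity of `κ(P) = k`
    have htr (z : ResField P) : algebraMap k (ResField P) (Algebra.trace k (ResField P) z) = z := by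
      obtain ⟨y, rfl⟩ := hPs P hPP z
      have hfr : Module.finrank k (ResField P) = 1 :=
        finrank_eq_one 1 one_ne_zero fun w => by
          obtain ⟨y, rfl⟩ := hPs P hPP w
          exact ⟨y, (Algebra.algebraMap_eq_smul_one y).symm⟩
      rw [Algebra.trace_algebraMap, hfr, one_smul]
    rw [htr, htr, hcoeff b hb, hcoeff b hb, constantCoeff_expansion_mul, mul_left_comm]
  · have hb : expansion k c.x (c.R * t) -
      MvPowerSeries.C (algebraMap k (ResField P) 0) * ∏ j, MvPowerSeries.X j ^ (c.a - 1) ∈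
        Ideal.span (Set.range fun j : Fin r =>
          (MvPowerSeries.X j ^ c.a : MvPowerSeries (Fin r) (ResField P))) := by
      simpa using hout hPP
    simp [hcoeff 0 hb]
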